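/- Let $K$ be a field of characteristic $0$, let $k\ge 3$, and let $KX_{k+1}$ be the vector space with basis $X_{k+1}=\{x_1,\ldots,x_{k+1}\}$. Let $F_{k+1}=L_{k+1}/L_{k+1}''$ be the free metabelian Lie algebra over $K$ freely generated by $X_{k+1}$, where $L_{k+1}$ is the free Lie algebra on $X_{k+1}$ and $L_{k+1}''=[[L_{k+1},L_{k+1}],[L_{k+1},L_{k+1}]]$. Let $SL_2(K)$ act linearly on $KX_{k+1}$ so that $KX_{k+1}\cong V_k$ as an $SL_2(K)$-module, where $V_k$ is the module of binary forms of degree $k$ over $K$ with the action $(gf)(v)=f(g^{-1}v)$, and extend this action diagonally to $F_{k+1}$ by $g(f(x_1,\ldots,x_{k+1}))=f(g(x_1),\ldots,g(x_{k+1}))$. Then the Lie algebra of invariants $$F_{k+1}^{SL_2(K)}=\{f\in F_{k+1}\mid g(f)=f\text{ for all }g\in SL_2(K)\}$$ is not finitely generated as a Lie algebra over $K$. -/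

import Mathlib

open scoped MatrixGroups

noncomputable section

/-! ### The free metabelian Lie algebra -/

/-- The free metabelian Lie algebra on the set `X` over `K`: the free Lie algebra `L` on `X` modulo
the second term `L'' = [[L, L], [L, L]]` of its derived series. -/
abbrev FreeMetabelianLie (K : Type*) [Field K] (X : Type*) : Type _ :=
  FreeLieAlgebra K X ⧸ LieAlgebra.derivedSeries K (FreeLieAlgebra K X) 2

namespace FreeMetabelianLie

variable (K : Type*) [Field K] (X : Type*)

/-- The free generators of the free metabelian Lie algebra. -/
def of (x : X) : FreeMetabelianLie K X :=
  LieSubmodule.Quotient.mk (FreeLieAlgebra.of K x)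

/-- The inclusion of the vector space `KX` with basis `X` (as the component of degree one). -/
def ofSpan : (X →₀ K) →ₗ[K] FreeMetabelianLie K X :=
  Finsupp.linearCombination K (of K X)

variable {K X}

/-- The endomorphism of the free Lie algebra on `X` which extends the linear map `φ : KX → KX`. -/
def freeLieMap (φ : (X →₀ K) →ₗ[K] (X →₀ K)) : FreeLieAlgebra K X →ₗ⁅K⁆ FreeLieAlgebra K X :=
  FreeLieAlgebra.lift K fun x =>
    Finsupp.linearCombination K (FreeLieAlgebra.of K) (φ (Finsupp.single x 1))

/-- A Lie endomorphism preserves the second derived ideal. -/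
theorem freeLieMap_mem (φ : (X →₀ K) →ₗ[K] (X →₀ K)) {u : FreeLieAlgebra K X}
    (hu : u ∈ LieAlgebra.derivedSeries K (FreeLieAlgebra K X) 2) :
    freeLieMap φ u ∈ LieAlgebra.derivedSeries K (FreeLieAlgebra K X) 2 :=
  LieIdeal.derivedSeries_map_le 2 (LieIdeal.mem_map (f := freeLieMap φ) hu)

/-- The diagonal extension of a linear map `φ : KX → KX` to an endomorphism of the free metabelian
Lie algebra, `f(x₁, x₂, …) ↦ f(φ x₁, φ x₂, …)`. -/
def map (φ : (X →₀ K) →ₗ[K] (X →₀ K)) : FreeMetabelianLie K X →ₗ⁅K⁆ FreeMetabelianLie K X :=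
  { Submodule.mapQ (LieAlgebra.derivedSeries K (FreeLieAlgebra K X) 2).toSubmodule
      (LieAlgebra.derivedSeries K (FreeLieAlgebra K X) 2).toSubmodule
      (freeLieMap φ : FreeLieAlgebra K X →ₗ[K] FreeLieAlgebra K X)
      (fun _ hu => freeLieMap_mem φ hu) with
    map_lie' := by
      intro a b
      obtain ⟨a, rfl⟩ := LieSubmodule.Quotient.surjective_mk' _ a
      obtain ⟨b, rfl⟩ := LieSubmodule.Quotient.surjective_mk' _ b
      exact congrArg (LieSubmodule.Quotient.mk
        (N := LieAlgebra.derivedSeries K (FreeLieAlgebra K X) 2)) ((freeLieMap φ).map_lie a b) }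

/-- On the generators, hence on `KX`, the extension is `φ` itself. -/
theorem map_of (φ : (X →₀ K) →ₗ[K] (X →₀ K)) (x : X) :
    map φ (of K X x) = ofSpan K X (φ (Finsupp.single x 1)) := by
  have h1 : map φ (of K X x)
      = LieSubmodule.Quotient.mk' _ (freeLieMap φ (FreeLieAlgebra.of K x)) := rfl
  rw [h1, freeLieMap, FreeLieAlgebra.lift_of_apply, ofSpan, Finsupp.linearCombination_apply,
    Finsupp.linearCombination_apply, Finsupp.sum, Finsupp.sum, map_sum]
  refine Finset.sum_congr rfl fun i _ => ?_
  rw [map_smul]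
  rfl

/-- The Lie algebra of invariants of a group `G` which acts on the free metabelian Lie algebra
by the diagonal extension of a linear action `ρ` on `KX`. -/
def invariants {G : Type*} [Group G] (ρ : Representation K G (X →₀ K)) :
    LieSubalgebra K (FreeMetabelianLie K X) where
  carrier := {f | ∀ g : G, map (ρ g) f = f}
  add_mem' {a b} ha hb g := by rw [map_add, ha g, hb g]
  zero_mem' g := map_zero _
  smul_mem' c a ha g := by rw [map_smul, ha g]
  lie_mem' {a b} ha hb g := by rw [LieHom.map_lie, ha g, hb g]

end FreeMetabelianLie

/-- A Lie subalgebra is finitely generated (as a Lie algebra) if it is the smallest Lie subalgebra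
which contains some finite set. -/
def LieSubalgebra.IsFinitelyGenerated {K L : Type*} [CommRing K] [LieRing L] [LieAlgebra K L]
    (H : LieSubalgebra K L) : Prop :=
  ∃ S : Finset L, LieSubalgebra.lieSpan K L (S : Set L) = H

/-! ### Binary forms -/

section BinaryForms

variable (K : Type*) [Field K]

/-- The substitution of variables `f(v) ↦ f(g⁻¹ v)`, `v = (u₁, u₂)`, in polynomials in two
variables. -/
def binarySubst (g : SL(2, K)) : MvPolynomial (Fin 2) K →ₐ[K] MvPolynomial (Fin 2) K :=
  MvPolynomial.aeval fun i => ∑ j, MvPolynomial.C ((g⁻¹ : SL(2, K)).1 i j) * MvPolynomial.X j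

theorem binarySubst_X (g : SL(2, K)) (i : Fin 2) : binarySubst K g (MvPolynomial.X i) =
    ∑ j, MvPolynomial.C ((g⁻¹ : SL(2, K)).1 i j) * MvPolynomial.X j := by
  simp [binarySubst]

theorem binarySubst_mem (k : ℕ) (g : SL(2, K)) {f : MvPolynomial (Fin 2) K}
    (hf : f ∈ MvPolynomial.homogeneousSubmodule (Fin 2) K k) :
    binarySubst K g f ∈ MvPolynomial.homogeneousSubmodule (Fin 2) K k := by
  rw [MvPolynomial.mem_homogeneousSubmodule] at hf ⊢
  have h := hf.aeval (fun i => ∑ j, MvPolynomial.C ((g⁻¹ : SL(2, K)).1 i j) * MvPolynomial.X j)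
    (n := 1) fun i => MvPolynomial.IsHomogeneous.sum _ _ _ fun j _ =>
      MvPolynomial.isHomogeneous_C_mul_X _ _
  rwa [one_mul] at h

theorem binarySubst_one : binarySubst K 1 = AlgHom.id K _ := by
  ext1 i
  fin_cases i <;> simp [binarySubst_X]

theorem binarySubst_mul (g h : SL(2, K)) :
    binarySubst K (g * h) = (binarySubst K g).comp (binarySubst K h) := by
  ext1 i
  rw [AlgHom.comp_apply, binarySubst_X, binarySubst_X, map_sum]
  simp only [map_mul, binarySubst_X, MvPolynomial.algHom_C, mul_inv_rev,
    Matrix.SpecialLinearGroup.coe_mul, Matrix.mul_apply, Fin.sum_univ_two, map_add,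
    MvPolynomial.algebraMap_eq]
  ring

/-- The `SL₂(K)`-module `V_k` of the binary forms of degree `k`, with `(g f)(v) = f(g⁻¹ v)`. -/
def binaryForms (k : ℕ) :
    Representation K SL(2, K) (MvPolynomial.homogeneousSubmodule (Fin 2) K k) where
  toFun g := (binarySubst K g).toLinearMap.restrict fun _ hf => binarySubst_mem K k g hf
  map_one' := by
    ext1 f
    apply Subtype.ext
    simp [LinearMap.restrict_apply, binarySubst_one]
  map_mul' g h := by
    ext1 f
    apply Subtype.ext
    simp only [LinearMap.restrict_apply, binarySubst_mul]
    rfl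

end BinaryForms

end

/-!
Write `F` for the free metabelian Lie algebra, `F'` for its commutator ideal and `S = K[X]` for the
polynomial ring. Since `V_k` has no nonzero invariants (`binaryForm_eq_zero_of_invariant`), the
invariants of `F` lie in `F'`, which is abelian. An abelian Lie algebra is finitely generated only
if it is finite-dimensional, so it suffices to find invariants that span an infinite-dimensional
space. The operators `ad x`, `x ∈ X`, commute on `F'` and make it an `S`-module (`polyAct`),
compatibly with the action of `SL₂`. So if `s ∈ S` and `w ∈ F'` are invariant, then so are all
`sⁿ w`. They are told apart by Lie homomorphisms from `F` to the Lie algebra of matrices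
`!![a, b; 0, 0]` over `K[t]` (`toAffine`), which send `x` to `!![y x, y' x; 0, 0]` for a polynomial
curve `y` with derivative `y'`; on `F'` the polynomial `s` then acts as multiplication by `s(y)`.
This is `not_isFinitelyGenerated_invariants`.

All invariants used come from the symbolic bracket `Δ = u ⊗ v - v ⊗ u`, which is fixed by `SL₂`
(`bracketTensor`), in the following way.

* For odd `k`, the tensor `Δ ^ k` is alternating and gives an invariant `w` of degree two in `F'`
  (`bracketCommutator`), and `s` is the discriminant of the quadratic covariant `(f, f)_{k-1}`
  (`quadCovariant`), an invariant of degree four.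
* For `k = 2m`, the tensor `Δ ^ k` is symmetric and gives a quadratic invariant `p`. A second
  invariant is the catalecticant `q`, the Hankel determinant of size `m + 1`: its matrix is
  transformed by the matrix of `g` on the forms of degree `m`, whose determinant is `±1` because it
  preserves the nondegenerate bilinear form `Δ ^ m`. Then `w` is the image in `F'` of `dp ∧ dq`
  (`diffWedge`), and `s = q`. Along a curve `y`, Euler's identity turns `w` into
  `2 P Q' - (m + 1) Q P'` with `P = p(y)` and `Q = q(y)`, which is nonzero if `Q` has a zero that is
  not a zero of `P` and `Q ≠ 0`. As `m ≥ 2`, such a curve passes through the form dual to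
  `u^k + v^k`, where the catalecticant matrix has rank two.
-/

noncomputable section

/-! ### The commutator ideal of the free metabelian Lie algebra -/

namespace FreeMetabelianLie

variable {K : Type*} [Field K] {X : Type*}

variable (K X) in
/-- The projection of the free Lie algebra onto the free metabelian Lie algebra. -/
def proj : FreeLieAlgebra K X →ₗ⁅K⁆ FreeMetabelianLie K X :=
  { ((LieSubmodule.Quotient.mk' (LieAlgebra.derivedSeries K (FreeLieAlgebra K X) 2) :
      FreeLieAlgebra K X →ₗ[K] FreeMetabelianLie K X)) with
    map_lie' := by intro a b; rfl }

theorem proj_surjective : Function.Surjective (proj K X) :=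
  LieSubmodule.Quotient.surjective_mk' _

theorem proj_of (x : X) : proj K X (FreeLieAlgebra.of K x) = of K X x := rfl

theorem proj_eq_zero {u : FreeLieAlgebra K X}
    (hu : u ∈ LieAlgebra.derivedSeries K (FreeLieAlgebra K X) 2) : proj K X u = 0 :=
  (LieSubmodule.Quotient.mk_eq_zero' (N := LieAlgebra.derivedSeries K (FreeLieAlgebra K X) 2)).2 hu

variable (K X) in
theorem derivedSeries_two_eq_bot :
    LieAlgebra.derivedSeries K (FreeMetabelianLie K X) 2 = ⊥ := by
  rw [← LieIdeal.derivedSeries_map_eq 2 (proj_surjective (K := K) (X := X)), LieIdeal.map_eq_bot_iff]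
  intro u hu
  exact proj_eq_zero hu

variable (K X) in
/-- The commutator ideal `F' = [F, F]` of the free metabelian Lie algebra `F`. -/
abbrev commutatorIdeal : LieIdeal K (FreeMetabelianLie K X) :=
  LieAlgebra.derivedSeries K (FreeMetabelianLie K X) 1

theorem lie_mem_commutatorIdeal (a b : FreeMetabelianLie K X) : ⁅a, b⁆ ∈ commutatorIdeal K X :=
  LieSubmodule.lie_mem_lie (LieSubmodule.mem_top a) (LieSubmodule.mem_top b)

theorem lie_eq_zero_of_mem {a b : FreeMetabelianLie K X} (ha : a ∈ commutatorIdeal K X)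
    (hb : b ∈ commutatorIdeal K X) : ⁅a, b⁆ = 0 := by
  have h : ⁅a, b⁆ ∈ LieAlgebra.derivedSeries K (FreeMetabelianLie K X) 2 :=
    LieSubmodule.lie_mem_lie ha hb
  rw [derivedSeries_two_eq_bot] at h
  exact h

theorem map_mem_commutatorIdeal (φ : (X →₀ K) →ₗ[K] (X →₀ K)) {a : FreeMetabelianLie K X}
    (ha : a ∈ commutatorIdeal K X) : map φ a ∈ commutatorIdeal K X :=
  LieIdeal.derivedSeries_map_le 1 (LieIdeal.mem_map (f := map φ) ha)

theorem map_ofSpan (φ : (X →₀ K) →ₗ[K] (X →₀ K)) (v : X →₀ K) :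
    map φ (ofSpan K X v) = ofSpan K X (φ v) := by
  have : (map φ : FreeMetabelianLie K X →ₗ[K] FreeMetabelianLie K X) ∘ₗ ofSpan K X
      = ofSpan K X ∘ₗ φ := by
    ext x
    simpa [ofSpan] using map_of φ x
  exact LinearMap.congr_fun this v

theorem ofSpan_single (x : X) : ofSpan K X (Finsupp.single x 1) = of K X x := by
  simp [ofSpan]

theorem exists_ofSpan_add (a : FreeMetabelianLie K X) :
    ∃ v : X →₀ K, ∃ d ∈ commutatorIdeal K X, a = ofSpan K X v + d := by
  -- The elements of this form are a Lie subalgebra that contains the generators.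
  let H : LieSubalgebra K (FreeMetabelianLie K X) :=
    { LinearMap.range (ofSpan K X) ⊔ (commutatorIdeal K X).toSubmodule with
      lie_mem' := fun {a b} _ _ =>
        Submodule.mem_sup_right (lie_mem_commutatorIdeal a b) }
  let f : FreeLieAlgebra K X →ₗ⁅K⁆ H := FreeLieAlgebra.lift K fun x =>
    ⟨of K X x, Submodule.mem_sup_left ⟨Finsupp.single x 1, ofSpan_single x⟩⟩
  have hf : H.incl.comp f = proj K X := by
    apply FreeLieAlgebra.hom_ext
    intro x
    simp [f, proj_of]
  obtain ⟨u, rfl⟩ := proj_surjective a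
  have hu : proj K X u ∈ LinearMap.range (ofSpan K X) ⊔ (commutatorIdeal K X).toSubmodule := by
    rw [← hf]
    exact (f u).2
  obtain ⟨_, ⟨v, rfl⟩, d, hd, h⟩ := Submodule.mem_sup.1 hu
  exact ⟨v, d, hd, h.symm⟩

/-! ### The action of the polynomial ring on the commutator ideal -/

theorem toEnd_commute (a b : FreeMetabelianLie K X) :
    LieModule.toEnd K (FreeMetabelianLie K X) (commutatorIdeal K X) a *
        LieModule.toEnd K (FreeMetabelianLie K X) (commutatorIdeal K X) b =
      LieModule.toEnd K (FreeMetabelianLie K X) (commutatorIdeal K X) b *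
        LieModule.toEnd K (FreeMetabelianLie K X) (commutatorIdeal K X) a := by
  ext d
  -- The Jacobi identity: `[a, [b, d]] = [[a, b], d] + [b, [a, d]]` with `[[a, b], d] = 0`.
  change ⁅a, ⁅b, (d : FreeMetabelianLie K X)⁆⁆ = ⁅b, ⁅a, (d : FreeMetabelianLie K X)⁆⁆
  rw [leibniz_lie, lie_eq_zero_of_mem (lie_mem_commutatorIdeal a b) d.2, zero_add]

variable (K X) in
/-- The subalgebra of `End F'` generated by the `ad a`, `a ∈ F`. -/
def adAlgebra : Subalgebra K (Module.End K (commutatorIdeal K X)) :=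
  Algebra.adjoin K
    (Set.range (LieModule.toEnd K (FreeMetabelianLie K X) (commutatorIdeal K X)))

instance : IsMulCommutative (adAlgebra K X) :=
  Algebra.isMulCommutative_adjoin K (by
    rintro _ ⟨a, rfl⟩ _ ⟨b, rfl⟩
    exact toEnd_commute a b)

open scoped IsMulCommutative in
variable (K X) in
/-- The action of `K[X]` on `F'`: since `F'` is abelian, the operators `ad x`, `x ∈ X`, commute
on it, and the variable `x` acts as `ad x`. -/
def polyAct : MvPolynomial X K →ₐ[K] Module.End K (commutatorIdeal K X) :=
  (adAlgebra K X).val.comp (MvPolynomial.aeval fun x =>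
    (⟨LieModule.toEnd K (FreeMetabelianLie K X) (commutatorIdeal K X) (of K X x),
      Algebra.subset_adjoin ⟨_, rfl⟩⟩ : adAlgebra K X))

theorem polyAct_X (x : X) (d : commutatorIdeal K X) :
    ((polyAct K X (MvPolynomial.X x) d : commutatorIdeal K X) : FreeMetabelianLie K X)
      = ⁅of K X x, (d : FreeMetabelianLie K X)⁆ := by
  simp [polyAct]

variable (K X) in
/-- The linear form `∑ vₓ x` in `K[X]` attached to a vector `v` of `KX`. -/
def linForm : (X →₀ K) →ₗ[K] MvPolynomial X K :=
  Finsupp.linearCombination K MvPolynomial.X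

theorem polyAct_linForm (v : X →₀ K) (d : commutatorIdeal K X) :
    ((polyAct K X (linForm K X v) d : commutatorIdeal K X) : FreeMetabelianLie K X)
      = ⁅ofSpan K X v, (d : FreeMetabelianLie K X)⁆ := by
  induction v using Finsupp.induction_linear with
  | zero => simp
  | add v w hv hw => simp [hv, hw]
  | single x c =>
    have : (Finsupp.single x c : X →₀ K) = c • Finsupp.single x 1 := by simp
    rw [this, map_smul, map_smul, map_smul, LinearMap.smul_apply, ofSpan_single]
    simp [linForm, polyAct_X]

/-- The endomorphism of the polynomial ring `K[X]` which extends the linear map `φ : KX → KX`. -/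
def polyMap (φ : (X →₀ K) →ₗ[K] (X →₀ K)) : MvPolynomial X K →ₐ[K] MvPolynomial X K :=
  MvPolynomial.aeval fun x => linForm K X (φ (Finsupp.single x 1))

theorem polyMap_linForm (φ : (X →₀ K) →ₗ[K] (X →₀ K)) (v : X →₀ K) :
    polyMap φ (linForm K X v) = linForm K X (φ v) := by
  have : (polyMap φ).toLinearMap ∘ₗ linForm K X = linForm K X ∘ₗ φ := by
    ext1 x
    ext1
    simp [polyMap, linForm]
  exact LinearMap.congr_fun this v

/-- The restriction of `map φ` to the commutator ideal. -/
def mapComm (φ : (X →₀ K) →ₗ[K] (X →₀ K)) : commutatorIdeal K X →ₗ[K] commutatorIdeal K X :=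
  (map φ : FreeMetabelianLie K X →ₗ[K] FreeMetabelianLie K X).restrict
    fun _ h => map_mem_commutatorIdeal φ h

theorem coe_mapComm (φ : (X →₀ K) →ₗ[K] (X →₀ K)) (d : commutatorIdeal K X) :
    (mapComm φ d : FreeMetabelianLie K X) = map φ d := rfl

theorem mapComm_polyAct (φ : (X →₀ K) →ₗ[K] (X →₀ K)) (p : MvPolynomial X K)
    (d : commutatorIdeal K X) :
    mapComm φ (polyAct K X p d) = polyAct K X (polyMap φ p) (mapComm φ d) := by
  induction p using MvPolynomial.induction_on generalizing d with
  | C c =>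
    have h1 : (MvPolynomial.C c : MvPolynomial X K) = algebraMap K _ c := rfl
    rw [h1, AlgHom.commutes, AlgHom.commutes, AlgHom.commutes]
    simp
  | add p q hp hq => simp [hp, hq]
  | mul_X p x hp =>
    rw [map_mul, map_mul, map_mul, Module.End.mul_apply, Module.End.mul_apply, hp]
    congr 1
    apply Subtype.ext
    rw [coe_mapComm, polyAct_X, LieHom.map_lie, map_of]
    simp only [polyMap, MvPolynomial.aeval_X]
    rw [polyAct_linForm, coe_mapComm]

/-! ### Representations of the free metabelian Lie algebra by affine maps -/

/-- The Lie algebra of pairs `(a, b)` with `[(a, b), (c, d)] = (0, ad - cb)`, that is, of the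
matrices `!![a, b; 0, 0]`, over a commutative ring. -/
@[ext] structure AffineLie (R : Type*) where
  /-- The linear part. -/
  lin : R
  /-- The translation part. -/
  trans : R

namespace AffineLie

variable {R : Type*} [CommRing R]

variable (R) in
/-- The additive group structure is that of `R × R`. -/
def equivProd : AffineLie R ≃ R × R where
  toFun a := (a.lin, a.trans)
  invFun a := ⟨a.1, a.2⟩

instance : AddCommGroup (AffineLie R) := (equivProd R).addCommGroup
instance [Algebra K R] : Module K (AffineLie R) := (equivProd R).module K

@[simp] theorem lin_add (a b : AffineLie R) : (a + b).lin = a.lin + b.lin := rfl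
@[simp] theorem trans_add (a b : AffineLie R) : (a + b).trans = a.trans + b.trans := rfl
@[simp] theorem lin_zero : (0 : AffineLie R).lin = 0 := rfl
@[simp] theorem trans_zero : (0 : AffineLie R).trans = 0 := rfl
@[simp] theorem lin_smul [Algebra K R] (c : K) (a : AffineLie R) : (c • a).lin = c • a.lin := rfl
@[simp] theorem trans_smul [Algebra K R] (c : K) (a : AffineLie R) :
    (c • a).trans = c • a.trans := rfl

instance : LieRing (AffineLie R) where
  bracket a b := ⟨0, a.lin * b.trans - b.lin * a.trans⟩
  add_lie a b c := by ext <;> simp; ring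
  lie_add a b c := by ext <;> simp; ring
  lie_self a := by ext <;> simp
  leibniz_lie a b c := by ext <;> simp; ring

@[simp] theorem lin_lie (a b : AffineLie R) : ⁅a, b⁆.lin = 0 := rfl
@[simp] theorem trans_lie (a b : AffineLie R) :
    ⁅a, b⁆.trans = a.lin * b.trans - b.lin * a.trans := rfl

instance [Algebra K R] : LieAlgebra K (AffineLie R) where
  lie_smul c a b := by ext <;> simp [smul_sub]

variable (K R) in
/-- The linear part as a linear map. -/
def linHom [Algebra K R] : AffineLie R →ₗ[K] R where
  toFun := lin
  map_add' _ _ := rfl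
  map_smul' _ _ := rfl

variable (K R) in
/-- The translation part as a linear map. -/
def transHom [Algebra K R] : AffineLie R →ₗ[K] R where
  toFun := trans
  map_add' _ _ := rfl
  map_smul' _ _ := rfl

theorem lin_eq_zero_of_mem [Algebra K R] {a : AffineLie R}
    (ha : a ∈ LieAlgebra.derivedSeries K (AffineLie R) 1) : a.lin = 0 := by
  have h : a ∈ (LieIdeal.toLieSubalgebra K (AffineLie R)
      (LieAlgebra.derivedSeries K (AffineLie R) 1)).toSubmodule := ha
  rw [LieAlgebra.coe_derivedSeries_one_eq] at h
  have h2 : Submodule.span K {⁅x, y⁆ | (x : AffineLie R) (y : AffineLie R)}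
      ≤ LinearMap.ker (linHom K R) := by
    rw [Submodule.span_le]
    rintro _ ⟨x, y, rfl⟩
    rfl
  exact h2 h

variable (K R) in
theorem derivedSeries_two_eq_bot [Algebra K R] :
    LieAlgebra.derivedSeries K (AffineLie R) 2 = ⊥ := by
  rw [LieAlgebra.derivedSeries_def, LieAlgebra.derivedSeriesOfIdeal_succ,
    LieSubmodule.lie_eq_bot_iff]
  intro a ha b hb
  ext <;> simp [lin_eq_zero_of_mem ha, lin_eq_zero_of_mem hb]

end AffineLie

section Affine

variable {R : Type*} [CommRing R] [Algebra K R]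

/-- The homomorphism of the free metabelian Lie algebra which sends the generator `x` to the
matrix `!![y x, z x; 0, 0]`. -/
def toAffine (y z : X → R) : FreeMetabelianLie K X →ₗ⁅K⁆ AffineLie R :=
  { Submodule.liftQ (LieAlgebra.derivedSeries K (FreeLieAlgebra K X) 2).toSubmodule
      (FreeLieAlgebra.lift K (fun x => (⟨y x, z x⟩ : AffineLie R)) :
        FreeLieAlgebra K X →ₗ[K] AffineLie R)
      (fun u hu => by
        have h := LieIdeal.derivedSeries_map_le 2 (LieIdeal.mem_map
          (f := FreeLieAlgebra.lift K (fun x => (⟨y x, z x⟩ : AffineLie R))) hu)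
        rw [AffineLie.derivedSeries_two_eq_bot] at h
        exact h) with
    map_lie' := by
      intro a b
      obtain ⟨a, rfl⟩ := LieSubmodule.Quotient.surjective_mk' _ a
      obtain ⟨b, rfl⟩ := LieSubmodule.Quotient.surjective_mk' _ b
      exact (FreeLieAlgebra.lift K (fun x => (⟨y x, z x⟩ : AffineLie R))).map_lie a b }

theorem toAffine_of (y z : X → R) (x : X) : toAffine (K := K) y z (of K X x) = ⟨y x, z x⟩ :=
  FreeLieAlgebra.lift_of_apply (fun x => (⟨y x, z x⟩ : AffineLie R)) x

theorem lin_toAffine_of_mem (y z : X → R) {d : FreeMetabelianLie K X}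
    (hd : d ∈ commutatorIdeal K X) : (toAffine (K := K) y z d).lin = 0 :=
  AffineLie.lin_eq_zero_of_mem
    (LieIdeal.derivedSeries_map_le 1 (LieIdeal.mem_map (f := toAffine (K := K) y z) hd))

theorem trans_toAffine_polyAct (y z : X → R) (p : MvPolynomial X K) (d : commutatorIdeal K X) :
    (toAffine (K := K) y z (polyAct K X p d : commutatorIdeal K X)).trans
      = MvPolynomial.aeval y p * (toAffine (K := K) y z d).trans := by
  induction p using MvPolynomial.induction_on generalizing d with
  | C c =>
    have h1 : (MvPolynomial.C c : MvPolynomial X K) = algebraMap K _ c := rfl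
    rw [h1, AlgHom.commutes, AlgHom.commutes]
    simp [Algebra.smul_def]
  | add p q hp hq => simp [hp, hq, add_mul]
  | mul_X p x hp =>
    rw [map_mul, map_mul, Module.End.mul_apply, hp, polyAct_X, LieHom.map_lie, toAffine_of]
    simp [lin_toAffine_of_mem y z d.2, mul_assoc]

theorem toAffine_ofSpan (lam mu : (X →₀ K) →ₗ[K] R) (v : X →₀ K) :
    toAffine (K := K) (fun x => lam (Finsupp.single x 1)) (fun x => mu (Finsupp.single x 1))
      (ofSpan K X v) = ⟨lam v, mu v⟩ := by
  have h1 : AffineLie.linHom K R ∘ₗ (toAffine (K := K) (fun x => lam (Finsupp.single x 1))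
      (fun x => mu (Finsupp.single x 1)) : FreeMetabelianLie K X →ₗ[K] AffineLie R)
      ∘ₗ ofSpan K X = lam := by
    ext x
    simp only [LinearMap.comp_apply, Finsupp.lsingle_apply, ofSpan_single, LieHom.coe_toLinearMap,
      toAffine_of]
    rfl
  have h2 : AffineLie.transHom K R ∘ₗ (toAffine (K := K) (fun x => lam (Finsupp.single x 1))
      (fun x => mu (Finsupp.single x 1)) : FreeMetabelianLie K X →ₗ[K] AffineLie R)
      ∘ₗ ofSpan K X = mu := by
    ext x
    simp only [LinearMap.comp_apply, Finsupp.lsingle_apply, ofSpan_single, LieHom.coe_toLinearMap,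
      toAffine_of]
    rfl
  ext
  · exact LinearMap.congr_fun h1 v
  · exact LinearMap.congr_fun h2 v

end Affine

theorem aeval_linForm {R : Type*} [CommRing R] [Algebra K R] (lam : (X →₀ K) →ₗ[K] R)
    (v : X →₀ K) :
    MvPolynomial.aeval (fun x => lam (Finsupp.single x 1)) (linForm K X v) = lam v := by
  have : (MvPolynomial.aeval (R := K) (fun x => lam (Finsupp.single x 1))).toLinearMap
      ∘ₗ linForm K X = lam := by
    ext x
    simp [linForm]
  exact LinearMap.congr_fun this v

end FreeMetabelianLie
end

noncomputable section

namespace FreeMetabelianLie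

variable {K : Type*} [Field K] {X : Type*}

/-! ### A criterion for the invariants not to be finitely generated -/

/-- If `KX` has no nonzero invariants, then the invariants of `F` lie in `F'`. -/
theorem invariants_le_commutatorIdeal {G : Type*} [Group G] {ρ : Representation K G (X →₀ K)}
    (h0 : ∀ v, (∀ g, ρ g v = v) → v = 0) {a : FreeMetabelianLie K X} (ha : a ∈ invariants ρ) :
    a ∈ commutatorIdeal K X := by
  obtain ⟨v, d, hd, rfl⟩ := exists_ofSpan_add a
  have hlin : ∀ (u : X →₀ K) (e : FreeMetabelianLie K X), e ∈ commutatorIdeal K X →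
      (toAffine (K := K) (fun x => linForm K X (Finsupp.single x 1))
        (fun x => linForm K X (Finsupp.single x 1)) (ofSpan K X u + e)).lin = linForm K X u := by
    intro u e he
    rw [map_add, AffineLie.lin_add, lin_toAffine_of_mem _ _ he, toAffine_ofSpan, add_zero]
  have hinj : Function.Injective (linForm K X) :=
    MvPolynomial.linearIndependent_X X K
  have hv : v = 0 := by
    refine h0 v fun g => hinj ?_
    have h1 := ha g
    rw [map_add, map_ofSpan] at h1
    rw [← hlin _ _ (map_mem_commutatorIdeal (ρ g) hd), h1, hlin _ _ hd]
  simpa [hv] using hd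

/-- The invariants of `F` lie in the abelian ideal `F'` as soon as `KX` has no nonzero invariants,
so if they were finitely generated, they would be finite-dimensional. But they contain all `sⁿ w`,
whose images in `K[t]` have unbounded degrees. -/
theorem not_isFinitelyGenerated_invariants {G : Type*} [Group G]
    {ρ : Representation K G (X →₀ K)} (h0 : ∀ v, (∀ g, ρ g v = v) → v = 0)
    {s : MvPolynomial X K} (hs : ∀ g, polyMap (ρ g) s = s)
    {w : commutatorIdeal K X} (hw : ∀ g, mapComm (ρ g) w = w)
    (y z : X → Polynomial K) (hsy : 0 < (MvPolynomial.aeval y s).natDegree)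
    (hwy : (toAffine (K := K) y z w).trans ≠ 0) :
    ¬ (invariants ρ).IsFinitelyGenerated := by
  rintro ⟨S, hS⟩
  have hSI : ∀ a ∈ S, a ∈ invariants ρ := fun a ha => by
    rw [← hS]
    exact LieSubalgebra.subset_lieSpan ha
  have hSD : Submodule.span K (S : Set (FreeMetabelianLie K X)) ≤
      (commutatorIdeal K X).toSubmodule :=
    Submodule.span_le.2 fun a ha => invariants_le_commutatorIdeal h0 (hSI a ha)
  let H : LieSubalgebra K (FreeMetabelianLie K X) :=
    { Submodule.span K (S : Set (FreeMetabelianLie K X)) with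
      lie_mem' := fun {a b} ha hb => by
        rw [lie_eq_zero_of_mem (hSD ha) (hSD hb)]
        exact Submodule.zero_mem _ }
  have hIH : invariants ρ ≤ H := by
    rw [← hS, LieSubalgebra.lieSpan_le]
    exact Submodule.subset_span
  let T : FreeMetabelianLie K X →ₗ[K] Polynomial K := AffineLie.transHom K (Polynomial K) ∘ₗ
    (toAffine (K := K) y z : FreeMetabelianLie K X →ₗ[K] AffineLie (Polynomial K))
  let N := S.sup fun a => (T a).natDegree
  have hdeg : ∀ a ∈ invariants ρ, (T a).natDegree ≤ N := by
    intro a ha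
    have h1 : Submodule.span K (S : Set (FreeMetabelianLie K X)) ≤
        (Polynomial.degreeLE K N).comap T := by
      rw [Submodule.span_le]
      intro b hb
      rw [SetLike.mem_coe, Submodule.mem_comap, Polynomial.mem_degreeLE,
        ← Polynomial.natDegree_le_iff_degree_le]
      exact Finset.le_sup (f := fun a => (T a).natDegree) hb
    have h2 := h1 (hIH ha)
    rwa [Submodule.mem_comap, Polynomial.mem_degreeLE,
      ← Polynomial.natDegree_le_iff_degree_le] at h2
  have hmem : ((polyAct K X (s ^ (N + 1)) w : commutatorIdeal K X) : FreeMetabelianLie K X)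
      ∈ invariants ρ := by
    intro g
    rw [← coe_mapComm, mapComm_polyAct, map_pow, hs, hw]
  have h1 := hdeg _ hmem
  have h2 : T (polyAct K X (s ^ (N + 1)) w : commutatorIdeal K X)
      = MvPolynomial.aeval y s ^ (N + 1) * (toAffine (K := K) y z w).trans := by
    rw [← map_pow]
    exact trans_toAffine_polyAct y z _ w
  have h3 : MvPolynomial.aeval y s ≠ 0 := by
    intro h
    simp [h] at hsy
  rw [h2, Polynomial.natDegree_mul (pow_ne_zero _ h3) hwy, Polynomial.natDegree_pow] at h1
  nlinarith

/-! ### Elements of the commutator ideal from tensors and from pairs of polynomials -/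

open TensorProduct in
variable (K X) in
/-- The linear map `v ⊗ w ↦ [v, w]` from `KX ⊗ KX` to `F'`. -/
def lieTensor : (X →₀ K) ⊗[K] (X →₀ K) →ₗ[K] commutatorIdeal K X :=
  TensorProduct.lift (LinearMap.mk₂ K
    (fun v w => ⟨⁅ofSpan K X v, ofSpan K X w⁆, lie_mem_commutatorIdeal _ _⟩)
    (fun _ _ _ => by ext; simp) (fun _ _ _ => by ext; simp)
    (fun _ _ _ => by ext; simp) (fun _ _ _ => by ext; simp))

open TensorProduct in
theorem coe_lieTensor_tmul (v w : X →₀ K) :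
    (lieTensor K X (v ⊗ₜ w) : FreeMetabelianLie K X) = ⁅ofSpan K X v, ofSpan K X w⁆ := rfl

theorem mapComm_lieTensor (φ : (X →₀ K) →ₗ[K] (X →₀ K)) (z) :
    mapComm φ (lieTensor K X z) = lieTensor K X (TensorProduct.map φ φ z) := by
  induction z using TensorProduct.induction_on with
  | zero => simp
  | add a b ha hb => simp [ha, hb]
  | tmul v w =>
    apply Subtype.ext
    rw [coe_mapComm, TensorProduct.map_tmul, coe_lieTensor_tmul, coe_lieTensor_tmul,
      LieHom.map_lie, map_ofSpan, map_ofSpan]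

theorem pderiv_linForm (v : X →₀ K) (i : X) :
    MvPolynomial.pderiv i (linForm K X v) = MvPolynomial.C (v i) := by
  classical
  induction v using Finsupp.induction_linear with
  | zero => simp
  | add v w hv hw => simp [hv, hw]
  | single x c =>
    simp only [linForm, Finsupp.linearCombination_single, Derivation.map_smul,
      MvPolynomial.pderiv_X]
    by_cases h : x = i
    · subst h
      simp [MvPolynomial.smul_eq_C_mul]
    · simp [h]

variable [Fintype X]

open TensorProduct in
/-- The image in `F'` of the wedge product `dp ∧ dq` of the differentials of two polynomials:
`∑ᵢⱼ ∂ᵢp ∂ⱼq [xᵢ, xⱼ]`. -/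
def diffWedge (p q : MvPolynomial X K) : commutatorIdeal K X :=
  ∑ i, ∑ j, polyAct K X (MvPolynomial.pderiv i p * MvPolynomial.pderiv j q)
    (lieTensor K X (Finsupp.single i 1 ⊗ₜ Finsupp.single j 1))

/-- The chain rule for a derivation of an algebra. -/
theorem derivation_aeval {A : Type*} [CommRing A] [Algebra K A] (D : Derivation K A A) (y : X → A)
    (p : MvPolynomial X K) :
    D (MvPolynomial.aeval y p) = ∑ i, MvPolynomial.aeval y (MvPolynomial.pderiv i p) * D (y i) := by
  classical
  induction p using MvPolynomial.induction_on with
  | C c => simp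
  | add p q hp hq => simp only [map_add, hp, hq, add_mul, Finset.sum_add_distrib]
  | mul_X p x hp =>
    have h1 : ∀ i, MvPolynomial.aeval y (MvPolynomial.pderiv i (p * MvPolynomial.X x)) * D (y i)
        = (if i = x then MvPolynomial.aeval y p * D (y x) else 0)
          + y x * (MvPolynomial.aeval y (MvPolynomial.pderiv i p) * D (y i)) := by
      intro i
      rw [Derivation.leibniz, MvPolynomial.pderiv_X, smul_eq_mul, smul_eq_mul, map_add, map_mul,
        map_mul, MvPolynomial.aeval_X, add_mul, mul_assoc (y x)]
      congr 1
      split_ifs with h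
      · subst h
        rw [Pi.single_eq_same, map_one, mul_one]
      · rw [Pi.single_eq_of_ne' h, map_zero, mul_zero, zero_mul]
    rw [Finset.sum_congr rfl fun i _ => h1 i, Finset.sum_add_distrib, Finset.sum_ite_eq',
      if_pos (Finset.mem_univ x), ← Finset.mul_sum, ← hp, map_mul, MvPolynomial.aeval_X,
      Derivation.leibniz, smul_eq_mul, smul_eq_mul]

theorem pderiv_polyMap (φ : (X →₀ K) →ₗ[K] (X →₀ K)) (p : MvPolynomial X K) (i : X) :
    MvPolynomial.pderiv i (polyMap φ p) = ∑ l, polyMap φ (MvPolynomial.pderiv l p) *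
      MvPolynomial.C (φ (Finsupp.single l 1) i) := by
  simp only [polyMap, derivation_aeval, pderiv_linForm]

open TensorProduct in
theorem mapComm_diffWedge (φ : (X →₀ K) →ₗ[K] (X →₀ K)) (p q : MvPolynomial X K) :
    mapComm φ (diffWedge p q) = diffWedge (polyMap φ p) (polyMap φ q) := by
  have hφ : ∀ l, φ (Finsupp.single l 1)
      = ∑ i, φ (Finsupp.single l 1) i • Finsupp.single i (1 : K) := by
    intro l
    simp only [Finsupp.smul_single, smul_eq_mul, mul_one]
    exact (Finsupp.univ_sum_single _).symm
  have hl : ∀ l r, lieTensor K X (φ (Finsupp.single l 1) ⊗ₜ φ (Finsupp.single r 1))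
      = ∑ i, ∑ j, (φ (Finsupp.single l 1) i * φ (Finsupp.single r 1) j) •
        lieTensor K X (Finsupp.single i 1 ⊗ₜ Finsupp.single j 1) := by
    intro l r
    conv_lhs => rw [hφ l, hφ r]
    simp only [TensorProduct.sum_tmul, TensorProduct.tmul_sum, map_sum,
      TensorProduct.smul_tmul_smul, map_smul]
    exact Finset.sum_comm
  have key : ∀ i j, polyAct K X (MvPolynomial.pderiv i (polyMap φ p) *
      MvPolynomial.pderiv j (polyMap φ q)) = ∑ l, ∑ r,
        (φ (Finsupp.single l 1) i * φ (Finsupp.single r 1) j) •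
        polyAct K X (polyMap φ (MvPolynomial.pderiv l p * MvPolynomial.pderiv r q)) := by
    intro i j
    rw [pderiv_polyMap, pderiv_polyMap, Finset.sum_mul_sum, map_sum]
    refine Finset.sum_congr rfl fun l _ => ?_
    rw [map_sum]
    refine Finset.sum_congr rfl fun r _ => ?_
    have h : polyMap φ (MvPolynomial.pderiv l p) * MvPolynomial.C (φ (Finsupp.single l 1) i) *
        (polyMap φ (MvPolynomial.pderiv r q) * MvPolynomial.C (φ (Finsupp.single r 1) j))
        = (φ (Finsupp.single l 1) i * φ (Finsupp.single r 1) j) •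
          polyMap φ (MvPolynomial.pderiv l p * MvPolynomial.pderiv r q) := by
      rw [map_mul (polyMap φ), MvPolynomial.smul_eq_C_mul, MvPolynomial.C_mul]
      ring
    rw [h]
    exact (polyAct K X).toLinearMap.map_smul _ _
  have hL : mapComm φ (diffWedge p q) = ∑ l, ∑ r, ∑ i, ∑ j,
      (φ (Finsupp.single l 1) i * φ (Finsupp.single r 1) j) •
        polyAct K X (polyMap φ (MvPolynomial.pderiv l p * MvPolynomial.pderiv r q))
          (lieTensor K X (Finsupp.single i 1 ⊗ₜ Finsupp.single j 1)) := by
    rw [diffWedge, map_sum]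
    refine Finset.sum_congr rfl fun l _ => ?_
    rw [map_sum]
    refine Finset.sum_congr rfl fun r _ => ?_
    rw [mapComm_polyAct, mapComm_lieTensor, TensorProduct.map_tmul, hl, map_sum]
    refine Finset.sum_congr rfl fun i _ => ?_
    rw [map_sum]
    exact Finset.sum_congr rfl fun j _ => LinearMap.map_smul _ _ _
  have hR : diffWedge (polyMap φ p) (polyMap φ q) = ∑ i, ∑ j, ∑ l, ∑ r,
      (φ (Finsupp.single l 1) i * φ (Finsupp.single r 1) j) •
        polyAct K X (polyMap φ (MvPolynomial.pderiv l p * MvPolynomial.pderiv r q))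
          (lieTensor K X (Finsupp.single i 1 ⊗ₜ Finsupp.single j 1)) := by
    rw [diffWedge]
    refine Finset.sum_congr rfl fun i _ => Finset.sum_congr rfl fun j _ => ?_
    rw [key, LinearMap.sum_apply]
    refine Finset.sum_congr rfl fun l _ => ?_
    rw [LinearMap.sum_apply]
    rfl
  rw [hL, hR, Finset.sum_congr rfl fun l _ => Finset.sum_comm, Finset.sum_comm]
  refine Finset.sum_congr rfl fun i _ => ?_
  rw [Finset.sum_congr rfl fun l _ => Finset.sum_comm, Finset.sum_comm]

theorem derivative_aeval (y : X → Polynomial K) (p : MvPolynomial X K) :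
    Polynomial.derivative (MvPolynomial.aeval y p)
      = ∑ i, MvPolynomial.aeval y (MvPolynomial.pderiv i p) * Polynomial.derivative (y i) :=
  derivation_aeval Polynomial.derivative' y p

theorem aeval_euler (y : X → Polynomial K) {p : MvPolynomial X K} {a : ℕ}
    (hp : p.IsHomogeneous a) :
    ∑ i, y i * MvPolynomial.aeval y (MvPolynomial.pderiv i p) = a • MvPolynomial.aeval y p := by
  have := congrArg (MvPolynomial.aeval y) hp.sum_X_mul_pderiv
  simpa only [map_sum, map_mul, MvPolynomial.aeval_X, map_nsmul] using this

/-- By Euler's identity, the element `dp ∧ dq` becomes `a P Q' - b Q P'` along a polynomial curve,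
where `P`, `Q` are the values of `p`, `q` along the curve and `a`, `b` are their degrees. -/
theorem trans_toAffine_diffWedge (y : X → Polynomial K) {p q : MvPolynomial X K} {a b : ℕ}
    (hp : p.IsHomogeneous a) (hq : q.IsHomogeneous b) :
    (toAffine (K := K) y (fun x => Polynomial.derivative (y x)) (diffWedge p q)).trans
      = a • MvPolynomial.aeval y p * Polynomial.derivative (MvPolynomial.aeval y q)
        - b • MvPolynomial.aeval y q * Polynomial.derivative (MvPolynomial.aeval y p) := by
  have hT : ∀ d : FreeMetabelianLie K X,
      (toAffine (K := K) y (fun x => Polynomial.derivative (y x)) d).trans =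
      (AffineLie.transHom K (Polynomial K) ∘ₗ (toAffine (K := K) y
        (fun x => Polynomial.derivative (y x)) : FreeMetabelianLie K X →ₗ[K] _)) d := fun _ => rfl
  have h1 : ∀ i j, (toAffine (K := K) y (fun x => Polynomial.derivative (y x))
      (polyAct K X (MvPolynomial.pderiv i p * MvPolynomial.pderiv j q) (lieTensor K X
        (TensorProduct.tmul K (Finsupp.single i 1) (Finsupp.single j 1))) :
        commutatorIdeal K X)).trans =
      (y i * MvPolynomial.aeval y (MvPolynomial.pderiv i p)) *
        (MvPolynomial.aeval y (MvPolynomial.pderiv j q) * Polynomial.derivative (y j)) -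
      (MvPolynomial.aeval y (MvPolynomial.pderiv i p) * Polynomial.derivative (y i)) *
        (y j * MvPolynomial.aeval y (MvPolynomial.pderiv j q)) := by
    intro i j
    rw [trans_toAffine_polyAct, coe_lieTensor_tmul, LieHom.map_lie, ofSpan_single, ofSpan_single,
      toAffine_of, toAffine_of, map_mul, AffineLie.trans_lie]
    ring
  rw [← aeval_euler y hp, ← aeval_euler y hq, derivative_aeval, derivative_aeval, hT, diffWedge,
    mul_comm (∑ i, y i * MvPolynomial.aeval y (MvPolynomial.pderiv i q))]
  simp only [AddSubmonoidClass.coe_finsetSum, map_sum]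
  simp only [← hT, h1, Finset.sum_sub_distrib, Finset.sum_mul_sum]

end FreeMetabelianLie
end

noncomputable section

open MvPolynomial TensorProduct

/-! ### Binary forms and the bracket tensor -/

section BinaryFormLemmas

variable {K : Type*} [Field K]

theorem homogeneousComponent_binarySubst (k : ℕ) (g : SL(2, K)) (f : MvPolynomial (Fin 2) K) :
    homogeneousComponent k (binarySubst K g f) = binarySubst K g (homogeneousComponent k f) := by
  have h : ∀ i, homogeneousComponent k (binarySubst K g (homogeneousComponent i f))
      = if i = k then binarySubst K g (homogeneousComponent k f) else 0 := by
    intro i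
    have hi := binarySubst_mem K i g (homogeneousComponent_mem (φ := f) i)
    rw [homogeneousComponent_of_mem hi]
    by_cases hik : i = k
    · subst hik; simp
    · rw [if_neg hik, if_neg (Ne.symm hik)]
  conv_lhs => rw [← sum_homogeneousComponent f, map_sum, map_sum]
  rw [Finset.sum_congr rfl fun i _ => h i, Finset.sum_ite_eq']
  split_ifs with hk
  · rfl
  · rw [homogeneousComponent_eq_zero _ _ (by simpa using hk), map_zero]

/-- There are no nonzero `SL₂`-invariant binary forms of positive degree, because `SL₂` moves any
nonzero vector to any other one, in particular to a proper multiple. -/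
theorem binaryForm_eq_zero_of_invariant [CharZero K] {k : ℕ} (hk : k ≠ 0)
    {f : MvPolynomial (Fin 2) K} (hf : f.IsHomogeneous k) (h : ∀ g, binarySubst K g f = f) :
    f = 0 := by
  have hscale : ∀ (c : K) (v : Fin 2 → K), eval (fun i => c * v i) f = c ^ k * eval v f := by
    intro c v
    rw [eval_eq, eval_eq, Finset.mul_sum]
    refine Finset.sum_congr rfl fun d hd => ?_
    simp only [mul_pow]
    rw [Finset.prod_mul_distrib, Finset.prod_pow_eq_pow_sum, ← hf.degree_eq_sum_deg_support hd]
    ring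
  have hmove : ∀ (a b c d : K), a * d - b * c = 1 → eval ![a, c] f = eval ![1, 0] f := by
    intro a b c d hdet
    let g : SL(2, K) := ⟨!![a, b; c, d], by rw [Matrix.det_fin_two_of]; exact hdet⟩
    have h1 : (eval ![1, 0]).comp (binarySubst K g⁻¹ : _ →+* MvPolynomial (Fin 2) K)
        = eval ![a, c] := by
      apply MvPolynomial.ringHom_ext
      · intro x
        simp [binarySubst]
      · intro i
        change eval ![1, 0] (binarySubst K g⁻¹ (X i)) = eval ![a, c] (X i)
        rw [binarySubst_X, inv_inv]
        fin_cases i <;> simp [g]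
    conv_rhs => rw [← h g⁻¹]
    exact (RingHom.congr_fun h1 f).symm
  have hne : ∀ a c : K, (a, c) ≠ 0 → eval ![a, c] f = eval ![1, 0] f := by
    intro a c hac
    by_cases ha : a = 0
    · have hc : c ≠ 0 := by
        rintro rfl
        exact hac (by simp [ha])
      exact hmove a (-c⁻¹) c 0 (by field_simp; simp)
    · exact hmove a 0 c a⁻¹ (by field_simp; simp)
  have h10 : eval ![1, 0] f = 0 := by
    have h1 := hne 2 0 (by simp)
    have h2 := hscale 2 ![1, 0]
    have h3 : (fun i => (2 : K) * (![1, 0] : Fin 2 → K) i) = ![2, 0] := by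
      ext i; fin_cases i <;> simp
    rw [h3, h1] at h2
    have h4 : (2 : K) ^ k ≠ 1 := by
      exact_mod_cast (Nat.one_lt_two_pow hk).ne'
    have h5 : ((2 : K) ^ k - 1) * eval ![1, 0] f = 0 := by linear_combination -h2
    exact (mul_eq_zero.1 h5).resolve_left (sub_ne_zero.2 h4)
  apply MvPolynomial.funext
  intro v
  rw [map_zero]
  have hv : v = ![v 0, v 1] := by ext i; fin_cases i <;> rfl
  by_cases h0 : (v 0, v 1) = 0
  · have h1 := hscale 0 ![1, 0]
    rw [zero_pow hk, zero_mul] at h1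
    rw [← h1]
    congr 2
    ext i
    simp only [Prod.mk_eq_zero] at h0
    fin_cases i <;> simp [h0]
  · rw [hv, hne _ _ h0, h10]

variable (K) in
/-- The monomial `u^l v^(n - l)` in two variables. -/
def binaryMonomial (n l : ℕ) : MvPolynomial (Fin 2) K := X 0 ^ l * X 1 ^ (n - l)

theorem isHomogeneous_binaryMonomial {n l : ℕ} (h : l ≤ n) :
    (binaryMonomial K n l).IsHomogeneous n := by
  have := ((isHomogeneous_X_pow (R := K) (0 : Fin 2) l).mul
    (isHomogeneous_X_pow (R := K) (1 : Fin 2) (n - l)))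
  rwa [Nat.add_sub_cancel' h] at this

theorem binaryMonomial_mul {m n i j : ℕ} (hi : i ≤ m) (hj : j ≤ n) :
    binaryMonomial K m i * binaryMonomial K n j = binaryMonomial K (m + n) (i + j) := by
  rw [binaryMonomial, binaryMonomial, binaryMonomial,
    show m + n - (i + j) = (m - i) + (n - j) by omega, pow_add, pow_add]
  ring

theorem X_zero_mul_binaryMonomial (n l : ℕ) :
    X 0 * binaryMonomial K n l = binaryMonomial K (n + 1) (l + 1) := by
  rw [binaryMonomial, binaryMonomial, Nat.add_sub_add_right, pow_succ]
  ring

theorem X_one_mul_binaryMonomial {n l : ℕ} (h : l ≤ n) :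
    X 1 * binaryMonomial K n l = binaryMonomial K (n + 1) l := by
  rw [binaryMonomial, binaryMonomial, Nat.sub_add_comm h, pow_succ]
  ring

variable (K) in
/-- The coefficient of a binary form of degree `n` at `u^l v^(n - l)`. -/
def binaryCoeff (n l : ℕ) : MvPolynomial (Fin 2) K →ₗ[K] K :=
  lcoeff K (Finsupp.single 0 l + Finsupp.single 1 (n - l))

theorem binaryMonomial_eq (n l : ℕ) : binaryMonomial K n l =
    monomial (Finsupp.single 0 l + Finsupp.single 1 (n - l)) 1 := by
  rw [binaryMonomial, X_pow_eq_monomial, X_pow_eq_monomial, monomial_mul, one_mul]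

theorem binaryCoeff_binaryMonomial (n l l' : ℕ) :
    binaryCoeff K n l (binaryMonomial K n l') = if l' = l then 1 else 0 := by
  rw [binaryCoeff, lcoeff_apply, binaryMonomial_eq, coeff_monomial]
  refine if_congr ⟨fun h => ?_, fun h => by rw [h]⟩ rfl rfl
  simpa using DFunLike.congr_fun h 0

theorem sum_binaryCoeff {n : ℕ} {f : MvPolynomial (Fin 2) K} (hf : f.IsHomogeneous n) :
    f = ∑ l : Fin (n + 1), binaryCoeff K n l f • binaryMonomial K n l := by
  ext d
  simp only [coeff_sum, coeff_smul, binaryMonomial_eq, coeff_monomial, smul_eq_mul]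
  by_cases hd : d 0 + d 1 = n
  · rw [Finset.sum_eq_single (⟨d 0, by omega⟩ : Fin (n + 1))]
    · have : Finsupp.single 0 (d 0) + Finsupp.single 1 (n - d 0) = d := by
        ext i
        fin_cases i
        · simp
        · simp; omega
      rw [if_pos this, mul_one, binaryCoeff, lcoeff_apply, this]
    · intro l _ hl
      rw [if_neg, mul_zero]
      rintro rfl
      apply hl
      ext
      simp
    · simp
  · rw [hf.coeff_eq_zero, Finset.sum_eq_zero]
    · intro l _
      rw [if_neg, mul_zero]
      rintro rfl
      apply hd
      have := l.2
      simp
      omega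
    · rwa [Finsupp.degree_eq_sum, Fin.sum_univ_two]

variable (K) in
/-- The symbolic bracket `u ⊗ v - v ⊗ u`. -/
def bracketTensor : MvPolynomial (Fin 2) K ⊗[K] MvPolynomial (Fin 2) K :=
  X 0 ⊗ₜ X 1 - X 1 ⊗ₜ X 0

variable (K) in
/-- The action of `SL₂` on pairs of binary forms. -/
def tensorSubst (g : SL(2, K)) : MvPolynomial (Fin 2) K ⊗[K] MvPolynomial (Fin 2) K →ₐ[K]
    MvPolynomial (Fin 2) K ⊗[K] MvPolynomial (Fin 2) K :=
  Algebra.TensorProduct.map (binarySubst K g) (binarySubst K g)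

theorem tensorSubst_tmul (g : SL(2, K)) (a b : MvPolynomial (Fin 2) K) :
    tensorSubst K g (a ⊗ₜ b) = binarySubst K g a ⊗ₜ binarySubst K g b := rfl

theorem binarySubst_X_smul (g : SL(2, K)) (i : Fin 2) : binarySubst K g (X i) =
    ∑ j, (g⁻¹ : SL(2, K)).1 i j • X j := by
  simp only [binarySubst_X, smul_eq_C_mul]

theorem tensorSubst_bracketTensor (g : SL(2, K)) :
    tensorSubst K g (bracketTensor K) = bracketTensor K := by
  have hdet : (g⁻¹ : SL(2, K)).1 0 0 * (g⁻¹ : SL(2, K)).1 1 1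
      - (g⁻¹ : SL(2, K)).1 0 1 * (g⁻¹ : SL(2, K)).1 1 0 = 1 := by
    rw [← Matrix.det_fin_two]
    exact (g⁻¹).2
  rw [bracketTensor, map_sub, tensorSubst_tmul, tensorSubst_tmul, binarySubst_X_smul,
    binarySubst_X_smul]
  generalize (g⁻¹ : SL(2, K)).1 = h at hdet
  simp only [Fin.sum_univ_two, TensorProduct.add_tmul, TensorProduct.tmul_add,
    TensorProduct.smul_tmul_smul]
  have h1 : h 0 0 * h 1 1 = 1 + h 0 1 * h 1 0 := by linear_combination hdet
  rw [mul_comm (h 1 0), mul_comm (h 1 0), mul_comm (h 1 1), mul_comm (h 1 1), h1]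
  module

theorem tensorSubst_bracketTensor_pow (g : SL(2, K)) (n : ℕ) :
    tensorSubst K g (bracketTensor K ^ n) = bracketTensor K ^ n := by
  rw [map_pow, tensorSubst_bracketTensor]

theorem bracketTensor_pow (n : ℕ) : bracketTensor K ^ n = ∑ l ∈ Finset.range (n + 1),
    ((-1) ^ (n - l) * n.choose l : K) • (binaryMonomial K n l ⊗ₜ binaryMonomial K n (n - l)) := by
  rw [bracketTensor, sub_eq_add_neg, add_pow]
  refine Finset.sum_congr rfl fun l hl => ?_
  have hl' : l ≤ n := by
    rw [Finset.mem_range] at hl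
    omega
  have h1 : (X 0 ⊗ₜ[K] X 1 : MvPolynomial (Fin 2) K ⊗[K] MvPolynomial (Fin 2) K) ^ l
      * (X 1 ⊗ₜ[K] X 0) ^ (n - l) = binaryMonomial K n l ⊗ₜ binaryMonomial K n (n - l) := by
    rw [Algebra.TensorProduct.tmul_pow, Algebra.TensorProduct.tmul_pow,
      Algebra.TensorProduct.tmul_mul_tmul, binaryMonomial, binaryMonomial, Nat.sub_sub_self hl',
      mul_comm (X 1 ^ l)]
  have h2 : ∀ (c : K) (z : MvPolynomial (Fin 2) K ⊗[K] MvPolynomial (Fin 2) K),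
      c • z = algebraMap K _ c * z := fun c z => Algebra.smul_def c z
  rw [← h1, h2,
    neg_pow (_ ⊗ₜ[K] _ : MvPolynomial (Fin 2) K ⊗[K] MvPolynomial (Fin 2) K), map_mul, map_pow,
    map_neg, map_one, map_natCast]
  ring

end BinaryFormLemmas

/-! ### The action of `SL₂` on monomials of fixed degree -/

section MonomialMatrix

variable {K : Type*} [Field K]

theorem det_antidiagonal_ne_zero {F : Type*} [Field F] {n : ℕ} (d : Fin n → F)
    (hd : ∀ i, d i ≠ 0) :
    (Matrix.of fun i j : Fin n => if j = i.rev then d i else 0).det ≠ 0 := by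
  have h : (Matrix.of fun i j : Fin n => if j = i.rev then d i else 0)
      = (Matrix.diagonal d).submatrix id Fin.revPerm := by
    ext i j
    rw [Matrix.of_apply, Matrix.submatrix_apply, Matrix.diagonal_apply]
    refine if_congr ?_ rfl rfl
    rw [id, Fin.revPerm_apply, ← Fin.rev_eq_iff, eq_comm]
  rw [h, Matrix.det_permute', Matrix.det_diagonal]
  refine mul_ne_zero ?_ (Finset.prod_ne_zero_iff.2 fun i _ => hd i)
  rcases Int.units_eq_one_or (Equiv.Perm.sign (Fin.revPerm : Equiv.Perm (Fin n))) with h | h <;>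
    simp [h]

variable (K) in
/-- The matrix of `g ∈ SL₂` on the binary forms of degree `m` with respect to the monomials. -/
def monomialMatrix (m : ℕ) (g : SL(2, K)) : Matrix (Fin (m + 1)) (Fin (m + 1)) K :=
  Matrix.of fun r i => binaryCoeff K m r (binarySubst K g (binaryMonomial K m i))

theorem binarySubst_binaryMonomial (m : ℕ) (g : SL(2, K)) (i : Fin (m + 1)) :
    binarySubst K g (binaryMonomial K m i)
      = ∑ r : Fin (m + 1), monomialMatrix K m g r i • binaryMonomial K m r :=
  sum_binaryCoeff (binarySubst_mem K m g (isHomogeneous_binaryMonomial i.is_le))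

/-- The matrix of `g` on the forms of degree `m` preserves the nondegenerate bilinear form given by
the `m`-th power of the symbolic bracket. -/
theorem det_monomialMatrix_sq [CharZero K] (m : ℕ) (g : SL(2, K)) :
    (monomialMatrix K m g).det ^ 2 = 1 := by
  let J : Matrix (Fin (m + 1)) (Fin (m + 1)) K :=
    Matrix.of fun i j => if j = i.rev then (-1) ^ (m - i) * (m.choose i : K) else 0
  have hJ0 : J.det ≠ 0 := by
    refine det_antidiagonal_ne_zero (fun i : Fin (m + 1) => (-1) ^ (m - i) * (m.choose i : K))
      fun i => mul_ne_zero (pow_ne_zero _ (by norm_num)) ?_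
    exact_mod_cast (Nat.choose_pos i.is_le).ne'
  have hJ : bracketTensor K ^ m = ∑ a : Fin (m + 1), ∑ b : Fin (m + 1),
      J a b • (binaryMonomial K m a ⊗ₜ[K] binaryMonomial K m b) := by
    rw [bracketTensor_pow, Finset.sum_range]
    refine Finset.sum_congr rfl fun a _ => ?_
    simp only [J, Matrix.of_apply, ite_smul, zero_smul, Finset.sum_ite_eq', Finset.mem_univ,
      if_true, Fin.val_rev, Nat.add_sub_add_right]
  let c : Fin (m + 1) → Fin (m + 1) →
      MvPolynomial (Fin 2) K ⊗[K] MvPolynomial (Fin 2) K →ₗ[K] K := fun r s =>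
    LinearMap.mul' K K ∘ₗ TensorProduct.map (binaryCoeff K m r) (binaryCoeff K m s)
  have hc : ∀ r s, c r s (bracketTensor K ^ m) = J r s := by
    intro r s
    rw [hJ]
    simp [c, binaryCoeff_binaryMonomial, Fin.val_inj]
  have hc' : ∀ r s, c r s (tensorSubst K g (bracketTensor K ^ m))
      = (monomialMatrix K m g * J * (monomialMatrix K m g).transpose) r s := by
    intro r s
    rw [hJ]
    simp only [map_sum, map_smul, tensorSubst_tmul, c, LinearMap.comp_apply,
      TensorProduct.map_tmul, LinearMap.mul'_apply, Matrix.mul_apply, Matrix.transpose_apply,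
      Finset.sum_mul, smul_eq_mul]
    rw [Finset.sum_comm]
    refine Finset.sum_congr rfl fun b _ => Finset.sum_congr rfl fun a _ => ?_
    simp only [monomialMatrix, Matrix.of_apply]
    ring
  have hM : monomialMatrix K m g * J * (monomialMatrix K m g).transpose = J := by
    ext r s
    rw [← hc', tensorSubst_bracketTensor_pow, hc]
  have hdet := congrArg Matrix.det hM
  rw [Matrix.det_mul, Matrix.det_mul, Matrix.det_transpose] at hdet
  apply mul_right_cancel₀ hJ0
  linear_combination hdet

end MonomialMatrix
end

noncomputable section

open MvPolynomial TensorProduct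

/-! ### Invariant polynomials and invariant commutators -/

section Invariants

open FreeMetabelianLie

variable {K : Type*} [Field K] {k : ℕ} {ρ : Representation K SL(2, K) (Fin (k + 1) →₀ K)}
  (e : ρ.Equiv (binaryForms K k))

/-- The vector of `KX` which corresponds to the component of degree `k` of a polynomial in two
variables. -/
def toVector : MvPolynomial (Fin 2) K →ₗ[K] (Fin (k + 1) →₀ K) :=
  e.toLinearEquiv.symm.toLinearMap ∘ₗ
    (homogeneousComponent k).codRestrict (homogeneousSubmodule (Fin 2) K k)
      fun f => (mem_homogeneousSubmodule k _).2 (homogeneousComponent_isHomogeneous k f)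

theorem toVector_binarySubst (g : SL(2, K)) (f : MvPolynomial (Fin 2) K) :
    toVector e (binarySubst K g f) = ρ g (toVector e f) := by
  have h := fun v => LinearMap.congr_fun (e.symm.isIntertwining' g) v
  refine Eq.trans ?_ (h _)
  refine congrArg e.toLinearEquiv.symm (Subtype.ext ?_)
  exact homogeneousComponent_binarySubst k g f

/-- The linear form in `K[X]` which corresponds to a binary form of degree `k`. -/
def toLinForm : MvPolynomial (Fin 2) K →ₗ[K] MvPolynomial (Fin (k + 1)) K :=
  linForm K (Fin (k + 1)) ∘ₗ toVector e

theorem polyMap_toLinForm (g : SL(2, K)) (f : MvPolynomial (Fin 2) K) :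
    polyMap (ρ g) (toLinForm e f) = toLinForm e (binarySubst K g f) := by
  rw [toLinForm, LinearMap.comp_apply, LinearMap.comp_apply, polyMap_linForm,
    toVector_binarySubst]

theorem isHomogeneous_toLinForm (f : MvPolynomial (Fin 2) K) :
    (toLinForm e f).IsHomogeneous 1 := by
  rw [toLinForm, LinearMap.comp_apply, linForm, Finsupp.linearCombination_apply, Finsupp.sum]
  refine IsHomogeneous.sum _ _ _ fun i _ => ?_
  rw [smul_eq_C_mul]
  exact isHomogeneous_C_mul_X _ _

/-- The quadratic form in `K[X]` which corresponds to a form of bidegree `(k, k)` in two pairs of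
variables. -/
def toQuadForm : MvPolynomial (Fin 2) K ⊗[K] MvPolynomial (Fin 2) K →ₗ[K]
    MvPolynomial (Fin (k + 1)) K :=
  LinearMap.mul' K _ ∘ₗ TensorProduct.map (toLinForm e) (toLinForm e)

theorem toQuadForm_tmul (a b : MvPolynomial (Fin 2) K) :
    toQuadForm e (a ⊗ₜ b) = toLinForm e a * toLinForm e b := rfl

theorem polyMap_toQuadForm (g : SL(2, K))
    (z : MvPolynomial (Fin 2) K ⊗[K] MvPolynomial (Fin 2) K) :
    polyMap (ρ g) (toQuadForm e z) = toQuadForm e (tensorSubst K g z) := by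
  induction z using TensorProduct.induction_on with
  | zero => simp
  | add a b ha hb => simp only [map_add, ha, hb]
  | tmul a b => rw [tensorSubst_tmul, toQuadForm_tmul, toQuadForm_tmul, map_mul,
      polyMap_toLinForm, polyMap_toLinForm]

theorem isHomogeneous_toQuadForm (z : MvPolynomial (Fin 2) K ⊗[K] MvPolynomial (Fin 2) K) :
    (toQuadForm e z).IsHomogeneous 2 := by
  induction z using TensorProduct.induction_on with
  | zero => rw [map_zero]; exact isHomogeneous_zero _ _ _
  | add a b ha hb => rw [map_add]; exact ha.add hb
  | tmul a b => exact (isHomogeneous_toLinForm e a).mul (isHomogeneous_toLinForm e b)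

/-- The element of `F'` which corresponds to the `k`-th power of the symbolic bracket. -/
def bracketCommutator : commutatorIdeal K (Fin (k + 1)) :=
  lieTensor K _ (TensorProduct.map (toVector e) (toVector e) (bracketTensor K ^ k))

theorem mapComm_bracketCommutator (g : SL(2, K)) :
    mapComm (ρ g) (bracketCommutator e) = bracketCommutator e := by
  have h : ∀ z, TensorProduct.map (ρ g) (ρ g) (TensorProduct.map (toVector e) (toVector e) z)
      = TensorProduct.map (toVector e) (toVector e) (tensorSubst K g z) := by
    intro z
    induction z using TensorProduct.induction_on with
    | zero => simp
    | add a b ha hb => simp only [map_add, ha, hb]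
    | tmul a b => rw [tensorSubst_tmul, TensorProduct.map_tmul, TensorProduct.map_tmul,
        TensorProduct.map_tmul, toVector_binarySubst, toVector_binarySubst]
  rw [bracketCommutator, mapComm_lieTensor, h, tensorSubst_bracketTensor_pow]

/-- The Gram matrix of the quadratic covariant of degree two of forms of degree `k = n + 1`:
the transvectant `(f, f)_n`. -/
def quadCovariant (n : ℕ) : Matrix (Fin 2) (Fin 2) (MvPolynomial (Fin (k + 1)) K) :=
  Matrix.of fun i j => toQuadForm e ((X i ⊗ₜ X j) * bracketTensor K ^ n)

theorem polyMap_det_quadCovariant (n : ℕ) (g : SL(2, K)) :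
    polyMap (ρ g) (quadCovariant e n).det = (quadCovariant e n).det := by
  let h : Matrix (Fin 2) (Fin 2) (MvPolynomial (Fin (k + 1)) K) :=
    (g⁻¹ : SL(2, K)).1.map (algebraMap K _)
  have hh : h.det = 1 := by
    have h1 := (RingHom.map_det (algebraMap K (MvPolynomial (Fin (k + 1)) K)) (g⁻¹ : SL(2, K)).1)
    rw [(g⁻¹ : SL(2, K)).2, map_one] at h1
    exact h1.symm
  have hB : (polyMap (ρ g)).mapMatrix (quadCovariant e n)
      = h * quadCovariant e n * h.transpose := by
    refine Matrix.ext fun i j => ?_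
    rw [AlgHom.mapMatrix_apply, Matrix.map_apply, quadCovariant, Matrix.of_apply,
      polyMap_toQuadForm, map_mul, tensorSubst_bracketTensor_pow, tensorSubst_tmul,
      binarySubst_X_smul, binarySubst_X_smul]
    simp only [Fin.sum_univ_two, TensorProduct.add_tmul, TensorProduct.tmul_add,
      TensorProduct.smul_tmul_smul, add_mul, smul_mul_assoc, map_add, map_smul,
      Matrix.mul_apply, Matrix.transpose_apply, h, Matrix.map_apply, Matrix.of_apply]
    simp only [Algebra.smul_def, map_mul]
    ring
  rw [AlgHom.map_det, hB, Matrix.det_mul, Matrix.det_mul, Matrix.det_transpose, hh]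
  ring

/-- The catalecticant matrix of forms of degree `k = 2m`. -/
def catalecticant (m : ℕ) : Matrix (Fin (m + 1)) (Fin (m + 1)) (MvPolynomial (Fin (k + 1)) K) :=
  Matrix.of fun i j => toLinForm e (binaryMonomial K m i * binaryMonomial K m j)

theorem polyMap_det_catalecticant [CharZero K] (m : ℕ) (g : SL(2, K)) :
    polyMap (ρ g) (catalecticant e m).det = (catalecticant e m).det := by
  let M : Matrix (Fin (m + 1)) (Fin (m + 1)) (MvPolynomial (Fin (k + 1)) K) :=
    (monomialMatrix K m g).map (algebraMap K _)
  have hM : M.det ^ 2 = 1 := by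
    have h1 := (RingHom.map_det (algebraMap K (MvPolynomial (Fin (k + 1)) K))
      (monomialMatrix K m g))
    have h2 : M.det = algebraMap K _ (monomialMatrix K m g).det := h1.symm
    rw [h2, ← map_pow, det_monomialMatrix_sq, map_one]
  have hA : (polyMap (ρ g)).mapMatrix (catalecticant e m)
      = M.transpose * catalecticant e m * M := by
    refine Matrix.ext fun i j => ?_
    rw [AlgHom.mapMatrix_apply, Matrix.map_apply, catalecticant, Matrix.of_apply,
      polyMap_toLinForm, map_mul, binarySubst_binaryMonomial, binarySubst_binaryMonomial,
      Finset.sum_mul_sum, Finset.sum_comm, map_sum, Matrix.mul_apply]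
    refine Finset.sum_congr rfl fun s _ => ?_
    rw [map_sum, Matrix.mul_apply, Finset.sum_mul]
    refine Finset.sum_congr rfl fun r _ => ?_
    rw [smul_mul_smul_comm, map_smul, Algebra.smul_def, map_mul, Matrix.transpose_apply,
      Matrix.of_apply]
    simp only [M, Matrix.map_apply]
    ring
  rw [AlgHom.map_det, hA, Matrix.det_mul, Matrix.det_mul, Matrix.det_transpose]
  linear_combination (catalecticant e m).det * hM

theorem isHomogeneous_det_catalecticant (m : ℕ) :
    (catalecticant e m).det.IsHomogeneous (m + 1) := by
  rw [Matrix.det_apply]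
  refine IsHomogeneous.sum _ _ _ fun σ _ => ?_
  have h : (∏ i, catalecticant e m (σ i) i).IsHomogeneous (∑ _i : Fin (m + 1), 1) :=
    IsHomogeneous.prod _ _ _ fun i _ => isHomogeneous_toLinForm e _
  rw [Finset.sum_const, Finset.card_univ, Fintype.card_fin, smul_eq_mul, mul_one] at h
  rcases Int.units_eq_one_or (Equiv.Perm.sign σ) with h1 | h1
  · rwa [h1, one_smul]
  · rw [h1, Units.neg_smul, one_smul]
    exact h.neg

theorem eq_zero_of_invariant [CharZero K] (hk : k ≠ 0) (e : ρ.Equiv (binaryForms K k))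
    (v : Fin (k + 1) →₀ K) (hv : ∀ g, ρ g v = v) : v = 0 := by
  have h1 : ∀ g, binarySubst K g (e.toLinearEquiv v).1 = (e.toLinearEquiv v).1 := by
    intro g
    have h2 : e.toLinearEquiv (ρ g v) = binaryForms K k g (e.toLinearEquiv v) :=
      LinearMap.congr_fun (e.isIntertwining' g) v
    rw [hv g] at h2
    exact (congrArg Subtype.val h2).symm
  have h3 := binaryForm_eq_zero_of_invariant hk (e.toLinearEquiv v).2 h1
  have h4 : e.toLinearEquiv v = 0 := Subtype.ext h3
  exact e.toLinearEquiv.map_eq_zero_iff.1 h4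

/-! ### Evaluation along a curve -/

/-- The values of a linear map on `KX` can be prescribed on the monomials of degree `k`. -/
theorem exists_linearMap_toVector {R : Type*} [CommRing R] [Algebra K R] (a : ℕ → R) :
    ∃ lam : (Fin (k + 1) →₀ K) →ₗ[K] R,
      ∀ l ≤ k, lam (toVector e (binaryMonomial K k l)) = a l := by
  let mu : MvPolynomial (Fin 2) K →ₗ[K] R :=
    ∑ l ∈ Finset.range (k + 1), (binaryCoeff K k l).smulRight (a l)
  refine ⟨mu ∘ₗ (homogeneousSubmodule (Fin 2) K k).subtype ∘ₗ e.toLinearEquiv.toLinearMap,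
    fun l hl => ?_⟩
  have h1 : ((e.toLinearEquiv (toVector e (binaryMonomial K k l)) :
      homogeneousSubmodule (Fin 2) K k) : MvPolynomial (Fin 2) K) = binaryMonomial K k l := by
    rw [toVector, LinearMap.comp_apply, LinearEquiv.coe_coe, LinearEquiv.apply_symm_apply]
    exact homogeneousComponent_eq_self (isHomogeneous_binaryMonomial hl)
  have h2 : mu (binaryMonomial K k l) = a l := by
    simp only [mu, LinearMap.sum_apply, LinearMap.smulRight_apply, binaryCoeff_binaryMonomial,
      ite_smul, one_smul, zero_smul]
    rw [Finset.sum_ite_eq, if_pos (Finset.mem_range.2 (by omega))]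
  rw [LinearMap.comp_apply, LinearMap.comp_apply, LinearEquiv.coe_coe, Submodule.subtype_apply,
    h1, h2]

section Curve

variable {R : Type*} [CommRing R] [Algebra K R] {lam : (Fin (k + 1) →₀ K) →ₗ[K] R} {a : ℕ → R}
  (hlam : ∀ l ≤ k, lam (toVector e (binaryMonomial K k l)) = a l)
include hlam

theorem aeval_toLinForm {l : ℕ} (hl : l ≤ k) :
    aeval (fun x => lam (Finsupp.single x 1)) (toLinForm e (binaryMonomial K k l)) = a l := by
  rw [toLinForm, LinearMap.comp_apply, aeval_linForm, hlam l hl]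

theorem aeval_toQuadForm_bracketTensor_pow :
    aeval (fun x => lam (Finsupp.single x 1)) (toQuadForm e (bracketTensor K ^ k))
      = ∑ l ∈ Finset.range (k + 1), ((-1) ^ (k - l) * k.choose l : K) • (a l * a (k - l)) := by
  rw [bracketTensor_pow, map_sum, map_sum]
  refine Finset.sum_congr rfl fun l hl => ?_
  have hl' : l ≤ k := by
    rw [Finset.mem_range] at hl
    omega
  rw [map_smul, map_smul, toQuadForm_tmul, map_mul, aeval_toLinForm e hlam hl',
    aeval_toLinForm e hlam (Nat.sub_le k l)]

theorem aeval_catalecticant {m : ℕ} (hm : k = m + m) (i j : Fin (m + 1)) :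
    aeval (fun x => lam (Finsupp.single x 1)) (catalecticant e m i j) = a (i + j) := by
  subst hm
  rw [catalecticant, Matrix.of_apply, binaryMonomial_mul i.is_le j.is_le,
    aeval_toLinForm e hlam (Nat.add_le_add i.is_le j.is_le)]

theorem aeval_quadCovariant {n : ℕ} (hn : k = n + 1) (i j : Fin 2) :
    aeval (fun x => lam (Finsupp.single x 1)) (quadCovariant e n i j)
      = ∑ l ∈ Finset.range (n + 1), ((-1) ^ (n - l) * n.choose l : K) •
        (a (l + 1 - i) * a (n - l + 1 - j)) := by
  subst hn
  have hX : ∀ (i : Fin 2) (l : ℕ), l ≤ n → aeval (fun x => lam (Finsupp.single x 1))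
      (toLinForm e (X i * binaryMonomial K n l)) = a (l + 1 - i) := by
    intro i l hl
    fin_cases i
    · simp only [Fin.zero_eta]
      rw [X_zero_mul_binaryMonomial, aeval_toLinForm e hlam (by omega)]
      rfl
    · simp only [Fin.mk_one]
      rw [X_one_mul_binaryMonomial hl, aeval_toLinForm e hlam (by omega)]
      rfl
  rw [quadCovariant, Matrix.of_apply, bracketTensor_pow, Finset.mul_sum, map_sum, map_sum]
  refine Finset.sum_congr rfl fun l hl => ?_
  have hl' : l ≤ n := by
    rw [Finset.mem_range] at hl
    omega
  rw [mul_smul_comm, map_smul, map_smul, Algebra.TensorProduct.tmul_mul_tmul, toQuadForm_tmul,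
    map_mul, hX i l hl', hX j _ (Nat.sub_le n l)]

end Curve

theorem trans_toAffine_bracketCommutator {lam : (Fin (k + 1) →₀ K) →ₗ[K] Polynomial K}
    {a : ℕ → Polynomial K}
    (hlam : ∀ l ≤ k, lam (toVector e (binaryMonomial K k l)) = a l) :
    (toAffine (K := K) (fun x => lam (Finsupp.single x 1))
      (fun x => Polynomial.derivative (lam (Finsupp.single x 1)))
      (bracketCommutator e : FreeMetabelianLie K (Fin (k + 1)))).trans
      = ∑ l ∈ Finset.range (k + 1), ((-1) ^ (k - l) * k.choose l : K) •
        (a l * Polynomial.derivative (a (k - l)) - a (k - l) * Polynomial.derivative (a l)) := by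
  let T : commutatorIdeal K (Fin (k + 1)) →ₗ[K] Polynomial K :=
    AffineLie.transHom K (Polynomial K) ∘ₗ
    (toAffine (K := K) (fun x => lam (Finsupp.single x 1))
      (fun x => Polynomial.derivative (lam (Finsupp.single x 1))) :
      FreeMetabelianLie K (Fin (k + 1)) →ₗ[K] AffineLie (Polynomial K)) ∘ₗ
    (commutatorIdeal K (Fin (k + 1))).toSubmodule.subtype
  change T (bracketCommutator e) = _
  rw [bracketCommutator, bracketTensor_pow, map_sum, map_sum, map_sum]
  refine Finset.sum_congr rfl fun l hl => ?_
  have hl' : l ≤ k := by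
    rw [Finset.mem_range] at hl
    omega
  rw [map_smul, map_smul, map_smul, TensorProduct.map_tmul]
  congr 1
  change (toAffine (K := K) (fun x => lam (Finsupp.single x 1))
      (fun x => (Polynomial.derivative ∘ₗ lam) (Finsupp.single x 1))
      ⁅ofSpan K _ (toVector e (binaryMonomial K k l)),
        ofSpan K _ (toVector e (binaryMonomial K k (k - l)))⁆).trans = _
  rw [LieHom.map_lie, toAffine_ofSpan, toAffine_ofSpan, AffineLie.trans_lie,
    LinearMap.comp_apply, LinearMap.comp_apply, hlam l hl', hlam _ (Nat.sub_le k l)]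

end Invariants
end

noncomputable section

open MvPolynomial TensorProduct FreeMetabelianLie

/-! ### Nonvanishing along suitable curves -/

/-- If `Q` vanishes at `0` and `P` does not, then `a P Q' = b Q P'` would give `Q'` at `0` a zero of
the same order as that of `Q`. -/
theorem nsmul_mul_derivative_sub_ne_zero {K : Type*} [Field K] [CharZero K] {P Q : Polynomial K}
    {a b : ℕ} (ha : a ≠ 0) (hP : P.eval 0 ≠ 0) (hQ : Q.eval 0 = 0) (hQ0 : Q ≠ 0) :
    a • P * Polynomial.derivative Q - b • Q * Polynomial.derivative P ≠ 0 := by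
  intro h
  have hroot : Q.IsRoot 0 := hQ
  have hpos : 0 < Q.rootMultiplicity 0 := (Polynomial.rootMultiplicity_pos hQ0).2 hroot
  have hQ' : Polynomial.derivative Q ≠ 0 := by
    intro h1
    have h2 := Polynomial.derivative_eq_zero.1 h1
    rw [Polynomial.eq_C_of_natDegree_eq_zero h2] at hQ hQ0
    rw [Polynomial.eval_C] at hQ
    exact hQ0 (by rw [hQ, map_zero])
  have hP0 : P ≠ 0 := by
    rintro rfl
    exact hP Polynomial.eval_zero
  have haP : a • P ≠ 0 := by
    rw [nsmul_eq_mul]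
    exact mul_ne_zero (Nat.cast_ne_zero.2 ha) hP0
  have haP0 : (a • P).rootMultiplicity 0 = 0 := by
    apply Polynomial.rootMultiplicity_eq_zero
    rw [Polynomial.IsRoot, Polynomial.eval_smul, nsmul_eq_mul]
    exact mul_ne_zero (Nat.cast_ne_zero.2 ha) hP
  have hdvd : (Polynomial.X - Polynomial.C (0 : K)) ^ Q.rootMultiplicity 0
      ∣ a • P * Polynomial.derivative Q := by
    rw [sub_eq_zero.1 h, smul_mul_assoc, nsmul_eq_mul]
    exact ((Polynomial.pow_rootMultiplicity_dvd Q 0).mul_right _).mul_left _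
  have h1 := (Polynomial.le_rootMultiplicity_iff (mul_ne_zero haP hQ')).2 hdvd
  rw [Polynomial.rootMultiplicity_mul (mul_ne_zero haP hQ'), haP0,
    Polynomial.derivative_rootMultiplicity_of_root hroot] at h1
  omega

theorem natDegree_pos_of_eval_ne {K : Type*} [Field K] {P : Polynomial K} {s t : K}
    (h : P.eval s ≠ P.eval t) : 0 < P.natDegree := by
  rw [Nat.pos_iff_ne_zero]
  intro h1
  rw [Polynomial.eq_C_of_natDegree_eq_zero h1] at h
  simp at h

/-- The case of odd `k`: along the curve of forms dual to `t, 0, …, 0, 1`, the determinant of the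
quadratic covariant becomes `-t²` and the invariant commutator becomes `2`. -/
theorem not_isFinitelyGenerated_invariants_of_odd {K : Type*} [Field K] [CharZero K] {k : ℕ}
    (hk : 3 ≤ k) (hodd : Odd k) {ρ : Representation K SL(2, K) (Fin (k + 1) →₀ K)}
    (e : ρ.Equiv (binaryForms K k)) : ¬ (invariants ρ).IsFinitelyGenerated := by
  obtain ⟨n, rfl⟩ : ∃ n, k = n + 1 := ⟨k - 1, by omega⟩
  have hn : Even n := by
    rcases Nat.even_or_odd n with h | h
    · exact h
    · exact absurd (h.add_one) (Nat.not_even_iff_odd.2 hodd)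
  let a : ℕ → Polynomial K := fun l => if l = n + 1 then 1 else if l = 0 then Polynomial.X else 0
  have ha0 : a 0 = Polynomial.X := by simp [a]
  have hak : a (n + 1) = 1 := by simp [a]
  have ham : ∀ l, l ≠ 0 → l ≠ n + 1 → a l = 0 := fun l h0 h1 => by simp [a, h0, h1]
  obtain ⟨lam, hlam⟩ := exists_linearMap_toVector e a
  have h00 : aeval (fun x => lam (Finsupp.single x 1)) (quadCovariant e n 0 0) = 0 := by
    rw [aeval_quadCovariant e hlam rfl]
    refine Finset.sum_eq_zero fun l hl => ?_
    rw [Finset.mem_range] at hl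
    by_cases h : l = n
    · rw [ham (n - l + 1 - (0 : Fin 2).val) (by simp) (by simp; omega), mul_zero, smul_zero]
    · rw [ham (l + 1 - (0 : Fin 2).val) (by simp) (by simp; omega), zero_mul, smul_zero]
  have h01 : aeval (fun x => lam (Finsupp.single x 1)) (quadCovariant e n 0 1)
      = Polynomial.X := by
    rw [aeval_quadCovariant e hlam rfl, Finset.sum_range_succ, Finset.sum_eq_zero]
    · simp [ha0, hak]
    · intro l hl
      rw [Finset.mem_range] at hl
      rw [ham (l + 1 - (0 : Fin 2).val) (by simp) (by simp; omega), zero_mul, smul_zero]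
  have h10 : aeval (fun x => lam (Finsupp.single x 1)) (quadCovariant e n 1 0)
      = Polynomial.X := by
    rw [aeval_quadCovariant e hlam rfl, Finset.sum_range_succ', Finset.sum_eq_zero]
    · simp [ha0, hak, hn.neg_one_pow]
    · intro l hl
      rw [Finset.mem_range] at hl
      rw [ham (l + 1 + 1 - (1 : Fin 2).val) (by simp) (by simp; omega), zero_mul, smul_zero]
  have hdet : aeval (fun x => lam (Finsupp.single x 1)) (quadCovariant e n).det
      = -(Polynomial.X ^ 2 : Polynomial K) := by
    rw [Matrix.det_fin_two, map_sub, map_mul, map_mul, h00, h01, h10]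
    ring
  refine not_isFinitelyGenerated_invariants
    (eq_zero_of_invariant (by omega) e)
    (polyMap_det_quadCovariant e n) (mapComm_bracketCommutator e)
    (fun x => lam (Finsupp.single x 1))
    (fun x => Polynomial.derivative (lam (Finsupp.single x 1))) ?_ ?_
  · rw [hdet, Polynomial.natDegree_neg, Polynomial.natDegree_X_pow]
    norm_num
  · have h2 : (2 : Polynomial K) ≠ 0 := two_ne_zero
    rw [trans_toAffine_bracketCommutator e hlam, Finset.sum_range_succ, Finset.sum_range_succ',
      Finset.sum_eq_zero]
    · convert h2 using 1
      simp only [Nat.sub_zero, Nat.sub_self, ha0, hak, Nat.choose_self, Nat.choose_zero_right,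
        hodd.neg_one_pow, Polynomial.derivative_X, Polynomial.derivative_one]
      simp
      norm_num
    · intro l hl
      rw [Finset.mem_range] at hl
      rw [ham (l + 1) (by omega) (by omega), ham (n + 1 - (l + 1)) (by omega) (by omega)]
      simp

/-- The case of even `k = 2m`: along the curve of forms dual to `1 - t, 0, …, t, …, 0, 1 - t`, the
catalecticant vanishes at `t = 0` but not at `t = 1`, and the quadratic invariant does not vanish
at `t = 0`. -/
theorem not_isFinitelyGenerated_invariants_of_even {K : Type*} [Field K] [CharZero K] {k : ℕ}
    (hk : 3 ≤ k) (heven : Even k) {ρ : Representation K SL(2, K) (Fin (k + 1) →₀ K)}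
    (e : ρ.Equiv (binaryForms K k)) : ¬ (invariants ρ).IsFinitelyGenerated := by
  obtain ⟨m, hm⟩ := heven
  let a : ℕ → Polynomial K := fun l =>
    if l = 0 ∨ l = k then 1 - Polynomial.X else if l = m then Polynomial.X else 0
  have ha0 : ∀ l, (a l).eval 0 = if l = 0 ∨ l = k then 1 else 0 := by
    intro l
    simp only [a]
    split_ifs <;> simp
  have ha1 : ∀ l, (a l).eval 1 = if l = m then 1 else 0 := by
    intro l
    simp only [a]
    split_ifs <;> first | omega | simp
  obtain ⟨lam, hlam⟩ := exists_linearMap_toVector e a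
  have hQ : ∀ t, (aeval (fun x => lam (Finsupp.single x 1)) (catalecticant e m).det).eval t
      = (Matrix.of fun i j : Fin (m + 1) => (a (i + j)).eval t).det := by
    intro t
    rw [AlgHom.map_det, ← Polynomial.coe_evalRingHom, RingHom.map_det]
    congr 1
    ext i j
    exact congrArg (Polynomial.eval t) (aeval_catalecticant e hlam hm i j)
  have hQ0 : (aeval (fun x => lam (Finsupp.single x 1)) (catalecticant e m).det).eval 0 = 0 := by
    rw [hQ]
    refine Matrix.det_eq_zero_of_row_eq_zero ⟨1, by omega⟩ fun j => ?_
    rw [Matrix.of_apply, ha0, if_neg]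
    have := j.2
    simp only
    omega
  have hQ1 : (aeval (fun x => lam (Finsupp.single x 1)) (catalecticant e m).det).eval 1 ≠ 0 := by
    rw [hQ]
    convert det_antidiagonal_ne_zero (fun _ : Fin (m + 1) => (1 : K)) fun _ => one_ne_zero using 2
    ext i j
    rw [Matrix.of_apply, Matrix.of_apply, ha1]
    refine if_congr ?_ rfl rfl
    rw [Fin.ext_iff, Fin.val_rev]
    have := i.2
    omega
  have hP0 : (aeval (fun x => lam (Finsupp.single x 1))
      (toQuadForm e (bracketTensor K ^ k))).eval 0 ≠ 0 := by
    rw [aeval_toQuadForm_bracketTensor_pow e hlam]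
    obtain ⟨n, hn⟩ : ∃ n, k = n + 1 := ⟨k - 1, by omega⟩
    have hkk : Even (n + 1) := ⟨m, by omega⟩
    subst hn
    rw [Finset.sum_range_succ, Finset.sum_range_succ', Polynomial.eval_add, Polynomial.eval_add,
      Polynomial.eval_finsetSum, Finset.sum_eq_zero]
    · simp [ha0, hkk.neg_one_pow]
    · intro l hl
      rw [Finset.mem_range] at hl
      rw [Polynomial.eval_smul, Polynomial.eval_mul, ha0, if_neg (by omega), zero_mul, smul_zero]
  have hQne : aeval (fun x => lam (Finsupp.single x 1)) (catalecticant e m).det ≠ 0 := by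
    intro h
    rw [h, Polynomial.eval_zero] at hQ1
    exact hQ1 rfl
  refine not_isFinitelyGenerated_invariants
    (eq_zero_of_invariant (by omega) e)
    (w := diffWedge (toQuadForm e (bracketTensor K ^ k)) (catalecticant e m).det)
    (polyMap_det_catalecticant e m) (fun g => ?_)
    (fun x => lam (Finsupp.single x 1))
    (fun x => Polynomial.derivative (lam (Finsupp.single x 1))) ?_ ?_
  · rw [mapComm_diffWedge, polyMap_det_catalecticant, polyMap_toQuadForm,
      tensorSubst_bracketTensor_pow]
  · exact natDegree_pos_of_eval_ne (s := 1) (t := 0) (by rw [hQ0]; exact hQ1)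
  · rw [trans_toAffine_diffWedge _ (isHomogeneous_toQuadForm e _)
      (isHomogeneous_det_catalecticant e m)]
    exact nsmul_mul_derivative_sub_ne_zero two_ne_zero hP0 hQ0 hQne

end

/-- Let `KX` be the vector space with basis `x₁, …, x_{k+1}`, `k ≥ 3`, over a field `K` of
characteristic zero, with an action `ρ` of `SL₂(K)` such that `KX ≅ V_k`. Then the Lie algebra of
`SL₂(K)`-invariants of the free metabelian Lie algebra on `x₁, …, x_{k+1}` is not finitely
generated. -/
theorem lemma3p3 {K : Type*} [Field K] [CharZero K] (k : ℕ) (hk : 3 ≤ k)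
    (ρ : Representation K SL(2, K) (Fin (k + 1) →₀ K))
    (hρ : Nonempty (ρ.Equiv (binaryForms K k))) :
    ¬ (FreeMetabelianLie.invariants ρ).IsFinitelyGenerated := by
  obtain ⟨e⟩ := hρ
  rcases Nat.even_or_odd k with h | h
  · exact not_isFinitelyGenerated_invariants_of_even hk h e
  · exact not_isFinitelyGenerated_invariants_of_odd hk h e
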